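/- Fix a gain $g\in\mathbb R$, a channel loss (reflectivity) $r\in[0,1]$, a detector efficiency $\eta\in[0,1]$ and $\alpha,\beta\in\mathbb C$, and put $C=r\tanh^2 g$. On the Fock space of one mode, with annihilation operator $a$, let $D(\delta)=e^{\delta a^\dagger-\delta^*a}$, given in the Fock basis by its exponential series, and let $M_0(\delta)=D(\delta)\,(1-\eta)^{a^\dagger a}D(\delta)^\dagger$ be the no-click POVM element of a displaced on/off detector of efficiency $\eta$. The series defining the matrix elements of $D(\delta)$ and $M_0(\delta)$ converge absolutely. (1) Perfect mode overlap. Let $A_0=\tfrac1{\sqrt2}$, $A_1=\tfrac{i}{\sqrt2}$ be the amplitudes of the lossless heralded state $\tfrac1{\sqrt2}(|0,1\rangle+i|1,0\rangle)$, and let the lossy heralded 1-photon state be $$\rho=(1-C)^3\sum_{p,q=0}^{1}A_pA_q^*\Big[\sum_{m\ge0}C^m\sqrt{\tbinom{m+p}{m}\tbinom{m+q}{m}}\,|m+p\rangle\langle m+q|\Big]\otimes\Big[\sum_{n\ge0}C^n\sqrt{\tbinom{n+1-p}{n}\tbinom{n+1-q}{n}}\,|n+1-p\rangle\langle n+1-q|\Big].$$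 Then $\operatorname{Tr}\rho=1$, and the probability $P_{1ph}(00|\alpha,\beta)=\operatorname{Tr}\big[\rho\,(M_0(\alpha)\otimes M_0(\beta))\big]$ that neither detector clicks (the double series of Fock matrix elements converging absolutely) equals $$\frac{(1-C)^3}{2}\cdot\frac{2(1-\eta)(1-C(1-\eta))+\eta^2\big(|\alpha|^2+|\beta|^2+2\,\mathrm{Im}(\alpha\beta^*)\big)}{(1-C(1-\eta))^4}\,\exp\Big(-\frac{\eta(1-C)(|\alpha|^2+|\beta|^2)}{1-C(1-\eta)}\Big).$$ (2) Imperfect mode overlap. Suppose moreover $g\neq0$ and $r<1$. Two two-mode squeezed vacua $\sum_n\frac{\tanh^n g}{\cosh g}|n,n\rangle$ are prepared. The photons of the two idler modes have spectral amplitudes $f,h\in L^2(\mathbb R)$ with $\|f\|=\|h\|=1$, each idler photon is lost with probability $r$ (beam-splitter loss, lost photons traced out), and the signal modes are conditioned on finding exactly one photon behind a symmetric beam splitter, without frequency resolution, in the output port that heralds $\tfrac1{\sqrt2}(|0,1\rangle+i|1,0\rangle)$; that is, on the projector $\int d\omega\,|c_\omega\rangle\langle c_\omega|$ with $\langle c_\omega|=\tfrac1{\sqrt2}\langle00|(a_\omega-i\,b_\omega)$,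 where $a_\omega,b_\omega$ annihilate an idler photon of frequency $\omega$ in the first and second beam. Let $\rho^v$ be the resulting normalized state of the two signal modes and $v=\int f^*(\omega)h(\omega)\,d\omega$ the visibility amplitude. Then $\operatorname{Tr}\rho^v=1$, and $\operatorname{Tr}\big[\rho^v\,(M_0(\alpha)\otimes M_0(\beta))\big]$ is given by the formula in (1) with $\mathrm{Im}(\alpha\beta^*)$ replaced by $\mathrm{Im}(v\,\alpha\beta^*)$. -/

import Mathlib

open Matrix MeasureTheory
open scoped Kronecker ComplexConjugate Nat

noncomputable section

namespace TwinField

/-! Operators of one bosonic mode are given by their (infinite) matrices in the Fock basis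
`|0⟩, |1⟩, …`, so that `A i j = ⟨i|A|j⟩`; operators of two modes are indexed by `ℕ × ℕ`. -/

/-- Product of operators in matrix form, `⟨i|AB|j⟩ = ∑ₖ ⟨i|A|k⟩⟨k|B|j⟩`. -/
def opMul {ι : Type*} (A B : Matrix ι ι ℂ) : Matrix ι ι ℂ :=
  fun i j => ∑' k, A i k * B k j

/-- All the series in the operator product `AB` converge absolutely. -/
def OpMulSummable {ι : Type*} (A B : Matrix ι ι ℂ) : Prop :=
  ∀ i j, Summable fun k => A i k * B k j

/-- Powers of an operator. -/
def opPow {ι : Type*} [DecidableEq ι] (A : Matrix ι ι ℂ) : ℕ → Matrix ι ι ℂ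
  | 0 => 1
  | k + 1 => opMul (opPow A k) A

/-- The `k`-th term `⟨i|Aᵏ|j⟩ / k!` of the exponential series of `A`. -/
def opExpTerm {ι : Type*} [DecidableEq ι] (A : Matrix ι ι ℂ) (i j : ι) (k : ℕ) : ℂ :=
  opPow A k i j / (k ! : ℂ)

/-- The exponential of an operator, `⟨i|exp A|j⟩ = ∑ₖ ⟨i|Aᵏ|j⟩ / k!`. -/
def opExp {ι : Type*} [DecidableEq ι] (A : Matrix ι ι ℂ) : Matrix ι ι ℂ :=
  fun i j => ∑' k, opExpTerm A i j k

/-- `ρ` has trace `z`. -/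
def HasOpTrace {ι : Type*} (ρ : Matrix ι ι ℂ) (z : ℂ) : Prop :=
  HasSum (fun x => ρ x x) z

/-- `Tr (ρ M) = z`: the double series `∑ ⟨x|ρ|y⟩⟨y|M|x⟩` converges absolutely to `z`. -/
def HasTraceMul {ι : Type*} (ρ M : Matrix ι ι ℂ) (z : ℂ) : Prop :=
  HasSum (fun xy : ι × ι => ρ xy.1 xy.2 * M xy.2 xy.1) z

/-- The annihilation operator, `a|n+1⟩ = √(n+1)|n⟩`, `a|0⟩ = 0`. -/
def annihilation : Matrix ℕ ℕ ℂ :=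
  fun i j => if j = i + 1 then (Real.sqrt j : ℂ) else 0

/-- The generator `δ a† - δ* a` of the displacement operator. -/
def displacementGenerator (δ : ℂ) : Matrix ℕ ℕ ℂ :=
  δ • annihilationᴴ - conj δ • annihilation

/-- The displacement operator `D(δ) = exp (δ a† - δ* a)`. -/
def displacement (δ : ℂ) : Matrix ℕ ℕ ℂ :=
  opExp (displacementGenerator δ)

/-- The no-click operator `E₀ = (1-η)^(a†a) = ∑ₘ (1-η)ᵐ |m⟩⟨m|` of a detector of efficiency `η`. -/
def noClick (η : ℝ) : Matrix ℕ ℕ ℂ :=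
  Matrix.diagonal fun m => (((1 - η) ^ m : ℝ) : ℂ)

/-- The no-click POVM element `M₀ = D(δ) E₀ D(δ)†` of a displaced on/off measurement. -/
def noClickPOVM (η : ℝ) (δ : ℂ) : Matrix ℕ ℕ ℂ :=
  opMul (opMul (displacement δ) (noClick η)) (displacement δ)ᴴ

/-! ### The lossy heralded state -/

/-- `∑ₘ Cᵐ √(binom(m+p, m) binom(m+q, m)) |m+p⟩⟨m+q|`. -/
def thermalLadder (C : ℝ) (p q : ℕ) : Matrix ℕ ℕ ℂ :=
  fun i j => ∑' m : ℕ, Matrix.single (m + p) (m + q)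
    ((C ^ m * Real.sqrt ((m + p).choose m * (m + q).choose m) : ℝ) : ℂ) i j

/-- The state shared by the signal modes when `σ` photons reach the central station through lossy
channels, `A` being the amplitudes of the lossless heralded state `∑ₙ A n |n, σ - n⟩`. -/
def lossyHeraldedState (C : ℝ) (σ : ℕ) (A : ℕ → ℂ) : Matrix (ℕ × ℕ) (ℕ × ℕ) ℂ :=
  (((1 - C) ^ (σ + 2) : ℝ) : ℂ) •
    ∑ p ∈ Finset.range (σ + 1), ∑ q ∈ Finset.range (σ + 1),
      (A p * conj (A q)) • (thermalLadder C p q ⊗ₖ thermalLadder C (σ - p) (σ - q))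

/-- Amplitudes of the lossless 1-photon state `(|0,1⟩ + i|1,0⟩)/√2`. -/
def onePhotonAmp (n : ℕ) : ℂ :=
  if n = 0 then 1 / (Real.sqrt 2 : ℂ) else if n = 1 then Complex.I / (Real.sqrt 2 : ℂ) else 0

/-- The lossy heralded 1-photon state. -/
def onePhotonState (C : ℝ) : Matrix (ℕ × ℕ) (ℕ × ℕ) ℂ :=
  lossyHeraldedState C 1 onePhotonAmp

/-! ### Heralding with imperfect spectral overlap of the two idler modes -/

/-- Vectors of the Fock space of the two idler beams, as wave functions of frequencies:
`Ψ n m w u` is the amplitude for `n` photons in the first beam at the frequencies `w` and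
`m` photons in the second beam at the frequencies `u`. -/
def IdlerVector : Type := (n m : ℕ) → (Fin n → ℝ) → (Fin m → ℝ) → ℂ

/-- `k` photons of spectral amplitude `f` in the first beam and `l` photons of spectral
amplitude `h` in the second. -/
def wavePackets (f h : ℝ → ℂ) (k l : ℕ) : IdlerVector :=
  fun n m w u => if n = k ∧ m = l then (∏ i, f (w i)) * ∏ j, h (u j) else 0

/-- Annihilation of a photon of frequency `ω` in the first beam. -/
def annihilateFst (ω : ℝ) (Ψ : IdlerVector) : IdlerVector :=
  fun n m w u => (Real.sqrt (n + 1) : ℂ) * Ψ (n + 1) m (Fin.cons ω w) u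

/-- Annihilation of a photon of frequency `ω` in the second beam. -/
def annihilateSnd (ω : ℝ) (Ψ : IdlerVector) : IdlerVector :=
  fun n m w u => (Real.sqrt (m + 1) : ℂ) * Ψ n (m + 1) w (Fin.cons ω u)

/-- The overlap with the vacuum of both beams. -/
def vacuumAmp (Ψ : IdlerVector) : ℂ :=
  Ψ 0 0 Fin.elim0 Fin.elim0

/-- `⟨00| (a_ω - i b_ω) / √2` applied to `Ψ`: behind the symmetric beam splitter, exactly one photon
is found, at the frequency `ω` and in the output port that heralds `(|0,1⟩ + i|1,0⟩)/√2`. -/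
def heraldAmp (ω : ℝ) (Ψ : IdlerVector) : ℂ :=
  (vacuumAmp (annihilateFst ω Ψ) - Complex.I * vacuumAmp (annihilateSnd ω Ψ)) / (Real.sqrt 2 : ℂ)

/-- Amplitude `√λₙ = tanhⁿ g / cosh g` of `|n,n⟩` in the two-mode squeezed vacuum of gain `g`. -/
def squeezedAmp (g : ℝ) (n : ℕ) : ℝ :=
  Real.tanh g ^ n / Real.cosh g

/-- Amplitude for the loss of `p` out of `n` photons at a beam splitter of reflectivity `r`. -/
def lossAmp (r : ℝ) (n p : ℕ) : ℝ :=
  Real.sqrt (n.choose p * (1 - r) ^ (n - p) * r ^ p)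

/-- The matrix element `⟨k,l| · |k',l'⟩` of the idlers, traced against the heralding projector
`∫ dω |c_ω⟩⟨c_ω|`, where `⟨c_ω| = ⟨00| (a_ω - i b_ω)/√2`. -/
def heraldOverlap (f h : ℝ → ℂ) (k l k' l' : ℕ) : ℂ :=
  ∫ ω, heraldAmp ω (wavePackets f h k l) * conj (heraldAmp ω (wavePackets f h k' l'))

/-- The unnormalized signal state after heralding. Two squeezed vacua of gain `g` are prepared,
the idlers have spectral amplitudes `f` and `h` and pass channels of loss `r`; `p` and `q` are the
numbers of photons lost, which are traced out. Rows are indexed by `(n, m)`, columns by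
`(n', m')`. -/
def unnormalizedHeralded (g r : ℝ) (f h : ℝ → ℂ) : Matrix (ℕ × ℕ) (ℕ × ℕ) ℂ :=
  fun x y =>
    ((squeezedAmp g x.1 * squeezedAmp g x.2 * squeezedAmp g y.1 * squeezedAmp g y.2 : ℝ) : ℂ) *
      ∑ p ∈ Finset.range (min x.1 y.1 + 1), ∑ q ∈ Finset.range (min x.2 y.2 + 1),
        ((lossAmp r x.1 p * lossAmp r y.1 p * lossAmp r x.2 q * lossAmp r y.2 q : ℝ) : ℂ) *
          heraldOverlap f h (x.1 - p) (x.2 - q) (y.1 - p) (y.2 - q)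

/-- The heralding probability. -/
def heraldingProb (g r : ℝ) (f h : ℝ → ℂ) : ℂ :=
  ∑' x, unnormalizedHeralded g r f h x x

/-- The heralded signal state. -/
def heraldedState (g r : ℝ) (f h : ℝ → ℂ) : Matrix (ℕ × ℕ) (ℕ × ℕ) ℂ :=
  (heraldingProb g r f h)⁻¹ • unnormalizedHeralded g r f h

/-- A normalized spectral amplitude. -/
def IsSpectralAmplitude (f : ℝ → ℂ) : Prop :=
  MemLp f 2 volume ∧ ∫ ω, ‖f ω‖ ^ 2 = 1

/-- The visibility amplitude `v = ∫ f*(ω) h(ω) dω`. -/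
def visibilityAmp (f h : ℝ → ℂ) : ℂ :=
  ∫ ω, conj (f ω) * h ω

end TwinField

end

/-!
Every operator involved has a Gaussian generating function in the Fock basis. With `H(c, x, y)ᵢⱼ =
i! j! [uⁱ sʲ] exp (c u s + x u + y s)` (`hermiteKernel`), the displacement operator is `⟨i|D(δ)|j⟩
= exp (-|δ|²/2) H(1, δ, -δ*)ᵢⱼ / √(i! j!)` (`displacement_apply`): replacing `δ` by `t δ` and `δ*`
by `t δ*` makes the right-hand side an entire function of `t` that satisfies the differential
equation of the exponential, so that its Taylor coefficients at `0` are the terms of the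
exponential series. The composition law `hasSum_hermiteKernel_mul` then gives the no-click
element, `⟨i|M₀(δ)|j⟩ = exp (-η |δ|²) H(1 - η, η δ, η δ*)ᵢⱼ / √(i! j!)` (`noClickPOVM_apply`).

Both states are, up to normalization, `½ (T₀₀ ⊗ T₁₁ + T₁₁ ⊗ T₀₀ + i v* T₁₀ ⊗ T₀₁ - i v T₀₁ ⊗ T₁₀)`
(`mixedHeralded`), where `T_pq` is `thermalLadder C p q` and `v = 1` for perfect overlap. For the
state heralded with spectral amplitudes `f` and `h` this holds because the heralding projector
factorizes over the two beams up to the overlaps `‖f‖² = ‖h‖² = 1` and `v` (`heraldOverlap_eq`),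
and because tracing out the lost photons of one squeezed vacuum produces a multiple of `T_pq`
(`squeezed_sum_lossAmp_eq`).

The probability is therefore a combination of products of the four traces `Tr (T_pq M₀(δ))`. They
are generating functions of the entries of `H` on and next to the diagonal: `Tr (T₀₀ M₀(δ))` is
that of the Laguerre polynomials (`hasSum_hermiteKernel_diag`), and the recurrences for `H`
express the other three through it by way of Cauchy products with geometric series.
-/

noncomputable section

namespace TwinField

theorem hasSum_of_eq {ι E : Type*} [AddCommMonoid E] [TopologicalSpace E] {u w : ι → E} {a b : E}
    (h : HasSum u a)
    (huw : ∀ k, w k = u k) (hab : b = a) : HasSum w b := by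
  rw [hab, funext huw]
  exact h

/-! ### Two-variable Hermite polynomials -/

/-- The two-variable Hermite polynomials `i! j! [uⁱ sʲ] exp (c u s + x u + y s)`. They are defined
by the recurrence obtained from `∂/∂u` of the generating function; at `j = 0` the truncated index
`j - 1` is harmless because of the factor `j`. -/
def hermiteKernel (c x y : ℂ) : ℕ → ℕ → ℂ
  | 0, j => y ^ j
  | i + 1, j => x * hermiteKernel c x y i j + c * j * hermiteKernel c x y i (j - 1)

theorem hermiteKernel_zero_left (c x y : ℂ) (j : ℕ) : hermiteKernel c x y 0 j = y ^ j := by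
  simp [hermiteKernel]

theorem hermiteKernel_succ_left (c x y : ℂ) (i j : ℕ) :
    hermiteKernel c x y (i + 1) j =
      x * hermiteKernel c x y i j + c * j * hermiteKernel c x y i (j - 1) := by
  rw [hermiteKernel]

/-- The recurrence obtained from `∂/∂s` of the generating function. -/
theorem hermiteKernel_succ_right (c x y : ℂ) (i j : ℕ) :
    hermiteKernel c x y i (j + 1) =
      y * hermiteKernel c x y i j + c * i * hermiteKernel c x y (i - 1) j := by
  induction i generalizing j with
  | zero => simp [hermiteKernel_zero_left, pow_succ']
  | succ i ih =>
    rw [hermiteKernel_succ_left, ih, hermiteKernel_succ_left]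
    simp only [Nat.add_sub_cancel]
    have hi : (i : ℂ) * hermiteKernel c x y i j =
        i * (x * hermiteKernel c x y (i - 1) j + c * j * hermiteKernel c x y (i - 1) (j - 1)) := by
      cases i with
      | zero => simp
      | succ i => rw [Nat.add_sub_cancel, hermiteKernel_succ_left]
    have hj : (j : ℂ) * hermiteKernel c x y i j =
        j * (y * hermiteKernel c x y i (j - 1) + c * i * hermiteKernel c x y (i - 1) (j - 1)) := by
      cases j with
      | zero => simp
      | succ j => rw [Nat.add_sub_cancel, ih]
    push_cast
    linear_combination c * hj - c * hi

theorem hermiteKernel_swap (c x y : ℂ) (i j : ℕ) :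
    hermiteKernel c x y i j = hermiteKernel c y x j i := by
  induction i generalizing j with
  | zero =>
    induction j with
    | zero => simp [hermiteKernel_zero_left]
    | succ j ih => simp [hermiteKernel_succ_left, hermiteKernel_succ_right, ih]
  | succ i ih => rw [hermiteKernel_succ_left, hermiteKernel_succ_right, ih, ih]

theorem conj_hermiteKernel (c x y : ℂ) (i j : ℕ) :
    conj (hermiteKernel c x y i j) = hermiteKernel (conj c) (conj x) (conj y) i j := by
  induction i generalizing j with
  | zero => simp [hermiteKernel_zero_left]
  | succ i ih => simp [hermiteKernel_succ_left, ih]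

theorem hermiteKernel_origin (i j : ℕ) :
    hermiteKernel 1 0 0 i j = if i = j then (i ! : ℂ) else 0 := by
  induction i generalizing j with
  | zero => cases j <;> simp [hermiteKernel_zero_left]
  | succ i ih =>
    cases j with
    | zero => simp [hermiteKernel_succ_left]
    | succ j =>
      simp only [hermiteKernel_succ_left, ih, Nat.add_sub_cancel, add_left_inj, zero_mul, zero_add,
        one_mul]
      split_ifs with h
      · rw [h, Nat.factorial_succ, Nat.cast_mul]
      · rw [mul_zero]

/-- Rescaling the variable conjugate to `j` in the generating function. -/
theorem hermiteKernel_mul_pow (c x y s : ℂ) (i j : ℕ) :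
    hermiteKernel c x y i j * s ^ j = hermiteKernel (c * s) x (y * s) i j := by
  induction i generalizing j with
  | zero => simp [hermiteKernel_zero_left, mul_pow]
  | succ i ih =>
    rw [hermiteKernel_succ_left, hermiteKernel_succ_left, ← ih, ← ih]
    cases j with
    | zero => simp
    | succ j => rw [Nat.add_sub_cancel]; ring

theorem hasDerivAt_hermiteKernel (c a b t : ℂ) (i j : ℕ) :
    HasDerivAt (fun t => hermiteKernel c (t * a) (t * b) i j)
      (a * i * hermiteKernel c (t * a) (t * b) (i - 1) j +
        b * j * hermiteKernel c (t * a) (t * b) i (j - 1)) t := by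
  induction i generalizing j with
  | zero =>
    simp only [hermiteKernel_zero_left]
    refine (((hasDerivAt_id t).mul_const b).pow j).congr_deriv ?_
    simp only [id, Nat.cast_zero]
    ring
  | succ i ih =>
    simp only [hermiteKernel_succ_left]
    refine ((((hasDerivAt_id t).mul_const a).mul (ih j)).add
      ((ih (j - 1)).const_mul (c * j))).congr_deriv ?_
    have hi : (i : ℂ) * hermiteKernel c (t * a) (t * b) i j =
        i * (t * a * hermiteKernel c (t * a) (t * b) (i - 1) j +
          c * j * hermiteKernel c (t * a) (t * b) (i - 1) (j - 1)) := by
      cases i with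
      | zero => simp
      | succ i => rw [Nat.add_sub_cancel, hermiteKernel_succ_left]
    simp only [Nat.add_sub_cancel, id]
    push_cast
    linear_combination -a * hi

/-- The terms with `k > j`, whose exponent `j - k` is truncated, vanish with `j.choose k`. -/
theorem hermiteKernel_eq_sum (c x y : ℂ) (i j : ℕ) :
    hermiteKernel c x y i j = ∑ k ∈ Finset.range (i + 1),
      (i.choose k * j.choose k * k ! : ℂ) * c ^ k * x ^ (i - k) * y ^ (j - k) := by
  induction i generalizing j with
  | zero => simp [hermiteKernel_zero_left]
  | succ i ih =>
    rw [hermiteKernel_succ_left, ih, ih, Finset.sum_range_succ' _ (i + 1)]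
    have h1 : ∀ k, ((i + 1).choose (k + 1) * j.choose (k + 1) * (k + 1)! : ℂ) * c ^ (k + 1) *
          x ^ (i + 1 - (k + 1)) * y ^ (j - (k + 1)) =
        (i.choose (k + 1) * j.choose (k + 1) * (k + 1)! : ℂ) * c ^ (k + 1) *
          x ^ (i + 1 - (k + 1)) * y ^ (j - (k + 1)) +
        c * j * ((i.choose k * (j - 1).choose k * k ! : ℂ) * c ^ k *
          x ^ (i - k) * y ^ (j - 1 - k)) := by
      intro k
      have h : (j : ℂ) * (j - 1).choose k = j.choose (k + 1) * (k + 1) := by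
        cases j with
        | zero => simp
        | succ j => exact_mod_cast Nat.add_one_mul_choose_eq j k
      rw [Nat.choose_succ_succ, Nat.factorial_succ, Nat.add_sub_add_right,
        show j - (k + 1) = j - 1 - k by omega]
      push_cast
      linear_combination (-(c * i.choose k * k ! * c ^ k * x ^ (i - k) * y ^ (j - 1 - k))) * h
    rw [Finset.sum_congr rfl fun k _ => h1 k, Finset.sum_add_distrib, ← Finset.mul_sum]
    have h2 : x * ∑ k ∈ Finset.range (i + 1),
          (i.choose k * j.choose k * k ! : ℂ) * c ^ k * x ^ (i - k) * y ^ (j - k) =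
        ∑ k ∈ Finset.range (i + 2),
          (i.choose k * j.choose k * k ! : ℂ) * c ^ k * x ^ (i + 1 - k) * y ^ (j - k) := by
      rw [Finset.sum_range_succ _ (i + 1), Finset.mul_sum]
      simp only [Nat.choose_succ_self, Nat.cast_zero, zero_mul, add_zero]
      refine Finset.sum_congr rfl fun k hk => ?_
      rw [Nat.succ_sub (by simpa [Nat.lt_succ_iff] using hk), pow_succ]
      ring
    rw [h2, Finset.sum_range_succ' _ (i + 1)]
    simp only [Nat.choose_zero_right]
    ring

/-- Composition of kernels: up to the factor `exp (y x')`, the product of two Gaussian generating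
functions is again one. The sum satisfies both recurrences of the right-hand side, so everything
reduces to the entry `(0, 0)`, which is the exponential series. -/
theorem hasSum_hermiteKernel_mul (c x y c' x' y' : ℂ) (i j : ℕ) :
    HasSum (fun k => hermiteKernel c x y i k * hermiteKernel c' x' y' k j / (k ! : ℂ))
      (Complex.exp (y * x') * hermiteKernel (c * c') (x + c * x') (y' + c' * y) i j) := by
  -- A factor `k` cancels against `k!` and shifts the summation index.
  have shift : ∀ {u : ℕ → ℂ} {z : ℂ}, HasSum (fun k => u (k + 1) / (k ! : ℂ)) z →
      HasSum (fun k => k * u k / (k ! : ℂ)) z := by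
    intro u z h
    rw [← hasSum_nat_add_iff' 1]
    refine hasSum_of_eq h (fun k => ?_) ?_
    · have : (k ! : ℂ) ≠ 0 := by exact_mod_cast k.factorial_ne_zero
      have : (k + 1 : ℂ) ≠ 0 := by exact_mod_cast k.succ_ne_zero
      push_cast [Nat.factorial_succ]
      field_simp
    · simp
  induction i generalizing j with
  | zero =>
    simp only [hermiteKernel_zero_left]
    induction j with
    | zero =>
      have := NormedSpace.expSeries_div_hasSum_exp (𝔸 := ℂ) (y * x')
      rw [← Complex.exp_eq_exp_ℂ] at this
      simpa [hermiteKernel_swap _ _ _ _ 0, hermiteKernel_zero_left, mul_pow] using this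
    | succ j ih =>
      have h := (shift (u := fun k => y ^ k * hermiteKernel c' x' y' (k - 1) j)
        (z := y * (Complex.exp (y * x') * (y' + c' * y) ^ j))
        (hasSum_of_eq (ih.mul_left y)
          (fun k => by simp only [Nat.add_sub_cancel]; ring) rfl)).mul_left c'
      refine hasSum_of_eq ((ih.mul_left y').add h) (fun k => ?_) ?_
      · rw [hermiteKernel_succ_right]; ring
      · ring
  | succ i ih =>
    have h := (shift (u := fun k => hermiteKernel c x y i (k - 1) * hermiteKernel c' x' y' k j)
      (z := x' * (Complex.exp (y * x') *
          hermiteKernel (c * c') (x + c * x') (y' + c' * y) i j) +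
        c' * j * (Complex.exp (y * x') *
          hermiteKernel (c * c') (x + c * x') (y' + c' * y) i (j - 1)))
      (hasSum_of_eq (((ih j).mul_left x').add ((ih (j - 1)).mul_left (c' * j)))
        (fun k => by simp only [Nat.add_sub_cancel, hermiteKernel_succ_left]; ring)
        rfl)).mul_left c
    refine hasSum_of_eq (((ih j).mul_left x).add h) (fun k => ?_) ?_
    · rw [hermiteKernel_succ_left]; ring
    · rw [hermiteKernel_succ_left]; ring

/-! ### Matrix elements of the displacement operator and of the no-click POVM element -/

/-- The normalization `√n!` of the Fock basis, as a complex number. -/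
def sqrtFactorial (n : ℕ) : ℂ := (Real.sqrt (n ! : ℝ) : ℂ)

theorem sqrtFactorial_ne_zero (n : ℕ) : sqrtFactorial n ≠ 0 := by
  have : (0 : ℝ) < n ! := by exact_mod_cast n.factorial_pos
  simpa [sqrtFactorial] using (Real.sqrt_pos.2 this).ne'

theorem sqrtFactorial_mul_self (n : ℕ) : sqrtFactorial n * sqrtFactorial n = n ! := by
  rw [sqrtFactorial, ← Complex.ofReal_mul, Real.mul_self_sqrt (by positivity)]
  simp

theorem sqrtFactorial_succ (n : ℕ) :
    sqrtFactorial (n + 1) = (Real.sqrt ((n + 1 : ℕ) : ℝ) : ℂ) * sqrtFactorial n := by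
  rw [sqrtFactorial, sqrtFactorial, ← Complex.ofReal_mul, ← Real.sqrt_mul (by positivity),
    Nat.factorial_succ, Nat.cast_mul]

theorem conj_sqrtFactorial (n : ℕ) : conj (sqrtFactorial n) = sqrtFactorial n :=
  Complex.conj_ofReal _

theorem ofReal_sqrt_mul_self (n : ℕ) :
    (Real.sqrt (n : ℝ) : ℂ) * (Real.sqrt (n : ℝ) : ℂ) = n := by
  rw [← Complex.ofReal_mul, Real.mul_self_sqrt (by positivity)]
  simp

/-- The columns of `δ a† - δ* a` have at most two nonzero entries. At `j = 0` the truncated index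
`j - 1` comes with the factor `√j = 0`. -/
theorem opPow_displacementGenerator_succ (δ : ℂ) (k i j : ℕ) :
    opPow (displacementGenerator δ) (k + 1) i j =
      δ * (Real.sqrt ((j + 1 : ℕ) : ℝ) : ℂ) * opPow (displacementGenerator δ) k i (j + 1) -
        conj δ * (Real.sqrt (j : ℝ) : ℂ) * opPow (displacementGenerator δ) k i (j - 1) := by
  set P := opPow (displacementGenerator δ) k with hP
  have h1 : HasSum (fun l => if l = j + 1 then
      δ * (Real.sqrt ((j + 1 : ℕ) : ℝ) : ℂ) * P i (j + 1) else 0)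
      (δ * (Real.sqrt ((j + 1 : ℕ) : ℝ) : ℂ) * P i (j + 1)) := hasSum_ite_eq _ _
  have h2 : HasSum (fun l => if l = j - 1 then
      conj δ * (Real.sqrt (j : ℝ) : ℂ) * P i (j - 1) else 0)
      (conj δ * (Real.sqrt (j : ℝ) : ℂ) * P i (j - 1)) := hasSum_ite_eq _ _
  rw [← (h1.sub h2).tsum_eq]
  change ∑' l, P i l * displacementGenerator δ l j = _
  refine tsum_congr fun l => ?_
  have hG : displacementGenerator δ l j =
      δ * (if l = j + 1 then (Real.sqrt ((j + 1 : ℕ) : ℝ) : ℂ) else 0) -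
        conj δ * (if l = j - 1 then (Real.sqrt (j : ℝ) : ℂ) else 0) := by
    simp only [displacementGenerator, Matrix.sub_apply, Matrix.smul_apply,
      Matrix.conjTranspose_apply, annihilation, smul_eq_mul]
    congr 2
    · split_ifs with h
      · subst h; simp
      · simp
    · rcases j with _ | j
      · simp
      · simp [eq_comm]
  rw [hG]
  split_ifs with ha hb hb
  · omega
  · rw [ha]; ring
  · rw [hb]; ring
  · ring

/-- The matrix element `⟨i|D(t δ)|j⟩`, continued analytically to complex `t`: the conjugate of `t
δ` is replaced by `t δ*`. -/
def displacementKernel (δ : ℂ) (i j : ℕ) (t : ℂ) : ℂ :=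
  Complex.exp (-(t ^ 2 * (δ * conj δ) / 2)) *
    hermiteKernel 1 (t * δ) (t * -conj δ) i j / (sqrtFactorial i * sqrtFactorial j)

/-- The differential equation `D(t)' = D(t) (δ a† - δ* a)`, entry by entry. -/
theorem hasDerivAt_displacementKernel (δ : ℂ) (i j : ℕ) (t : ℂ) :
    HasDerivAt (displacementKernel δ i j)
      (δ * (Real.sqrt ((j + 1 : ℕ) : ℝ) : ℂ) * displacementKernel δ i (j + 1) t -
        conj δ * (Real.sqrt (j : ℝ) : ℂ) * displacementKernel δ i (j - 1) t) t := by
  have he : HasDerivAt (fun t : ℂ => Complex.exp (-(t ^ 2 * (δ * conj δ) / 2)))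
      (Complex.exp (-(t ^ 2 * (δ * conj δ) / 2)) * -(t * (δ * conj δ))) t := by
    refine ((((hasDerivAt_pow 2 t).mul_const (δ * conj δ)).div_const 2).neg.cexp).congr_deriv ?_
    simp only [Pi.neg_apply]
    push_cast
    ring
  refine ((he.mul (hasDerivAt_hermiteKernel 1 δ (-conj δ) t i j)).div_const
    (sqrtFactorial i * sqrtFactorial j)).congr_deriv ?_
  have hi := sqrtFactorial_ne_zero i
  have hj := sqrtFactorial_ne_zero j
  have h1 : (Real.sqrt ((j + 1 : ℕ) : ℝ) : ℂ) * displacementKernel δ i (j + 1) t =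
      Complex.exp (-(t ^ 2 * (δ * conj δ) / 2)) *
        hermiteKernel 1 (t * δ) (t * -conj δ) i (j + 1) / (sqrtFactorial i * sqrtFactorial j) := by
    have h0 : (Real.sqrt ((j + 1 : ℕ) : ℝ) : ℂ) ≠ 0 := by
      have : (0 : ℝ) < ((j + 1 : ℕ) : ℝ) := by positivity
      exact_mod_cast (Real.sqrt_pos.2 this).ne'
    rw [displacementKernel, sqrtFactorial_succ]
    field_simp
  have h2 : (Real.sqrt (j : ℝ) : ℂ) * displacementKernel δ i (j - 1) t =
      Complex.exp (-(t ^ 2 * (δ * conj δ) / 2)) *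
        (j * hermiteKernel 1 (t * δ) (t * -conj δ) i (j - 1)) /
          (sqrtFactorial i * sqrtFactorial j) := by
    cases j with
    | zero => simp
    | succ j =>
      have h0 : (Real.sqrt ((j + 1 : ℕ) : ℝ) : ℂ) ≠ 0 := by
        have : (0 : ℝ) < ((j + 1 : ℕ) : ℝ) := by positivity
        exact_mod_cast (Real.sqrt_pos.2 this).ne'
      have hj := sqrtFactorial_ne_zero j
      rw [displacementKernel, Nat.add_sub_cancel, sqrtFactorial_succ,
        ← ofReal_sqrt_mul_self (j + 1)]
      field_simp
  rw [mul_assoc δ (Real.sqrt ((j + 1 : ℕ) : ℝ) : ℂ), h1, mul_assoc (conj δ) (Real.sqrt (j : ℝ) : ℂ),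
    h2, hermiteKernel_succ_right]
  field_simp
  ring

theorem iteratedDeriv_displacementKernel_zero (δ : ℂ) (k i j : ℕ) :
    iteratedDeriv k (displacementKernel δ i j) 0 = opPow (displacementGenerator δ) k i j := by
  have hd : ∀ j, Differentiable ℂ (displacementKernel δ i j) :=
    fun j t => (hasDerivAt_displacementKernel δ i j t).differentiableAt
  have hc : ∀ (n : ℕ) (j), ContDiffAt ℂ n (displacementKernel δ i j) 0 :=
    fun n j => (hd j).contDiff.contDiffAt
  induction k generalizing j with
  | zero =>
    have := sqrtFactorial_mul_self i
    rw [iteratedDeriv_zero, opPow, displacementKernel, Matrix.one_apply]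
    simp only [zero_mul, hermiteKernel_origin]
    split_ifs with h
    · subst h
      rw [this]
      have : (i ! : ℂ) ≠ 0 := by exact_mod_cast i.factorial_ne_zero
      simp [this]
    · simp
  | succ k ih =>
    have h : deriv (displacementKernel δ i j) =
        (fun t => δ * (Real.sqrt ((j + 1 : ℕ) : ℝ) : ℂ) * displacementKernel δ i (j + 1) t) -
        (fun t => conj δ * (Real.sqrt (j : ℝ) : ℂ) * displacementKernel δ i (j - 1) t) :=
      funext fun t => (hasDerivAt_displacementKernel δ i j t).deriv
    rw [iteratedDeriv_succ', h, iteratedDeriv_sub (contDiffAt_const.mul (hc _ _))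
      (contDiffAt_const.mul (hc _ _)), iteratedDeriv_const_mul_field,
      iteratedDeriv_const_mul_field, ih, ih, opPow_displacementGenerator_succ]

/-- The exponential series of `δ a† - δ* a` is the Taylor series at `0` of an entire function of
`t`, evaluated at `t = 1`; this gives its convergence as well as its value. -/
theorem hasSum_opExpTerm_displacementGenerator (δ : ℂ) (i j : ℕ) :
    HasSum (opExpTerm (displacementGenerator δ) i j) (displacementKernel δ i j 1) := by
  have hd : Differentiable ℂ (displacementKernel δ i j) :=
    fun t => (hasDerivAt_displacementKernel δ i j t).differentiableAt
  refine hasSum_of_eq (Complex.hasSum_taylorSeries_of_entire hd 0 1) (fun k => ?_) rfl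
  rw [iteratedDeriv_displacementKernel_zero, opExpTerm, sub_zero, one_pow, one_smul, smul_eq_mul]
  ring

theorem displacement_apply (δ : ℂ) (i j : ℕ) :
    displacement δ i j = Complex.exp (-(δ * conj δ / 2)) *
      hermiteKernel 1 δ (-conj δ) i j / (sqrtFactorial i * sqrtFactorial j) := by
  rw [displacement, opExp, (hasSum_opExpTerm_displacementGenerator δ i j).tsum_eq,
    displacementKernel]
  simp only [one_pow, one_mul]

theorem displacement_mul_noClick_apply (η : ℝ) (δ : ℂ) (i j : ℕ) :
    opMul (displacement δ) (noClick η) i j = displacement δ i j * (1 - η : ℂ) ^ j := by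
  rw [opMul, tsum_eq_single j]
  · simp [noClick]
  · intro k hk
    simp [noClick, Matrix.diagonal_apply_ne _ hk]

/-- The normal-ordered form `M₀(δ) = :exp (-η (a† - δ*)(a - δ)):` in the Fock basis. -/
theorem hasSum_noClickPOVM (η : ℝ) (δ : ℂ) (i j : ℕ) :
    HasSum (fun k => opMul (displacement δ) (noClick η) i k * (displacement δ)ᴴ k j)
      (Complex.exp (-(η * (δ * conj δ))) *
        hermiteKernel (1 - η) (η * δ) (η * conj δ) i j /
          (sqrtFactorial i * sqrtFactorial j)) := by
  have h := (hasSum_hermiteKernel_mul (1 * (1 - η : ℂ)) δ (-conj δ * (1 - η)) 1 (-δ) (conj δ)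
    i j).mul_left (Complex.exp (-(δ * conj δ)) / (sqrtFactorial i * sqrtFactorial j))
  refine hasSum_of_eq h (fun k => ?_) ?_
  · have hc : conj (Complex.exp (-(δ * conj δ / 2))) = Complex.exp (-(δ * conj δ / 2)) := by
      rw [← Complex.exp_conj]
      simp [mul_comm, map_ofNat]
    have he : Complex.exp (-(δ * conj δ)) =
        Complex.exp (-(δ * conj δ / 2)) * Complex.exp (-(δ * conj δ / 2)) := by
      rw [← Complex.exp_add]; ring_nf
    rw [displacement_mul_noClick_apply, Matrix.conjTranspose_apply, displacement_apply,
      displacement_apply, ← hermiteKernel_mul_pow, he, ← sqrtFactorial_mul_self k,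
      hermiteKernel_swap _ (-δ)]
    simp only [map_div₀, map_mul, ← starRingEnd_apply, hc, conj_hermiteKernel,
      conj_sqrtFactorial, map_neg, map_one, Complex.conj_conj]
    have := sqrtFactorial_ne_zero i
    have := sqrtFactorial_ne_zero j
    have := sqrtFactorial_ne_zero k
    field_simp
  · have he : Complex.exp (-(η * (δ * conj δ))) =
        Complex.exp (-(δ * conj δ)) * Complex.exp (-conj δ * (1 - η) * -δ) := by
      rw [← Complex.exp_add]; ring_nf
    rw [he, show 1 * (1 - η : ℂ) * 1 = 1 - η by ring,
      show δ + 1 * (1 - η : ℂ) * -δ = η * δ by ring,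
      show conj δ + 1 * (-conj δ * (1 - η : ℂ)) = η * conj δ by ring]
    ring

theorem noClickPOVM_apply (η : ℝ) (δ : ℂ) (i j : ℕ) :
    noClickPOVM η δ i j = Complex.exp (-(η * (δ * conj δ))) *
        hermiteKernel (1 - η) (η * δ) (η * conj δ) i j / (sqrtFactorial i * sqrtFactorial j) :=
  (hasSum_noClickPOVM η δ i j).tsum_eq

/-! ### Generating functions of the entries near the diagonal -/

/-- The solution of `uₘ₊₁ = wₘ₊₁ + q uₘ` is the Cauchy product of `w` with a geometric series. -/
theorem hasSum_of_geometric_recurrence {u w : ℕ → ℂ} {q W : ℂ} (hq : ‖q‖ < 1) (hw : HasSum w W)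
    (h0 : u 0 = w 0) (hu : ∀ m, u (m + 1) = w (m + 1) + q * u m) :
    HasSum u (W / (1 - q)) := by
  have hsum : ∀ m, u m = ∑ ij ∈ Finset.HasAntidiagonal.antidiagonal m, w ij.1 * q ^ ij.2 := by
    intro m
    induction m with
    | zero => simp [h0]
    | succ m ih =>
      rw [Finset.Nat.sum_antidiagonal_succ', hu, ih, Finset.mul_sum, pow_zero, mul_one]
      refine congrArg₂ _ rfl (Finset.sum_congr rfl fun ij _ => ?_)
      rw [pow_succ]; ring
  have hgeom := hasSum_geometric_of_norm_lt_one hq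
  have hs := (summable_norm_sum_mul_antidiagonal_of_summable_norm hw.summable.norm
    hgeom.summable.norm).of_norm
  have ht := tsum_mul_tsum_eq_tsum_sum_antidiagonal_of_summable_norm hw.summable.norm
    hgeom.summable.norm
  rw [hw.tsum_eq, hgeom.tsum_eq] at ht
  rw [funext hsum, div_eq_mul_inv, ht]
  exact hs.hasSum

/-- The Laguerre-type expansion of the diagonal entries. -/
theorem hermiteKernel_self_div_factorial (c x y : ℂ) (m : ℕ) :
    hermiteKernel c x y m m / (m ! : ℂ) = ∑ kn ∈ Finset.HasAntidiagonal.antidiagonal m,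
      ((kn.2 + kn.1).choose kn.1 : ℂ) * c ^ kn.2 * ((x * y) ^ kn.1 / (kn.1 ! : ℂ)) := by
  rw [hermiteKernel_eq_sum, ← Finset.Nat.sum_antidiagonal_swap, Finset.sum_div]
  simp only [Prod.fst_swap, Prod.snd_swap]
  rw [Finset.Nat.sum_antidiagonal_eq_sum_range_succ
    (fun n k => ((n + k).choose k : ℂ) * c ^ n * ((x * y) ^ k / (k ! : ℂ)))]
  refine Finset.sum_congr rfl fun n hn => ?_
  have hn : n ≤ m := Nat.lt_succ_iff.1 (Finset.mem_range.1 hn)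
  have h : (m.choose n * n ! * (m - n)! : ℂ) = m ! := by
    exact_mod_cast Nat.choose_mul_factorial_mul_factorial hn
  have h1 : (m ! : ℂ) ≠ 0 := by exact_mod_cast m.factorial_ne_zero
  have h2 : ((m - n)! : ℂ) ≠ 0 := by exact_mod_cast (m - n).factorial_ne_zero
  rw [Nat.add_sub_cancel' hn, Nat.choose_symm hn, mul_pow]
  field_simp
  linear_combination (m.choose n * c ^ n * x ^ (m - n) * y ^ (m - n) : ℂ) * h

/-- The generating function of the Laguerre polynomials. Summed first over the number `n` of
factors `c`, the double series is a negative binomial series; summed over antidiagonals it is the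
left-hand side. -/
theorem hasSum_hermiteKernel_diag {c t : ℂ} (x y : ℂ) (htc : ‖t * c‖ < 1) :
    HasSum (fun m => t ^ m * (hermiteKernel c x y m m / (m ! : ℂ)))
      (Complex.exp (t * (x * y) / (1 - t * c)) / (1 - t * c)) := by
  set w : ℕ × ℕ → ℂ := fun kn =>
    ((kn.2 + kn.1).choose kn.1 : ℂ) * (t * c) ^ kn.2 * ((t * (x * y)) ^ kn.1 / (kn.1 ! : ℂ)) with hw
  have hfiber : ∀ k, HasSum (fun n => w (k, n))
      (1 / (1 - t * c) ^ (k + 1) * ((t * (x * y)) ^ k / (k ! : ℂ))) := fun k =>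
    hasSum_of_eq ((hasSum_choose_mul_geometric_of_norm_lt_one k htc).mul_right
      ((t * (x * y)) ^ k / (k ! : ℂ))) (fun _ => rfl) rfl
  -- The same sums with absolute values give absolute convergence of the double series.
  have hfiber' : ∀ k, HasSum (fun n => ‖w (k, n)‖)
      (1 / (1 - ‖t * c‖) ^ (k + 1) * (‖t * (x * y)‖ ^ k / (k ! : ℝ))) := fun k => by
    have := (hasSum_choose_mul_geometric_of_norm_lt_one (r := ‖t * c‖) k
      (by rwa [norm_norm])).mul_right (‖t * (x * y)‖ ^ k / (k ! : ℝ))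
    refine hasSum_of_eq this (fun n => ?_) rfl
    simp only [hw, norm_mul, norm_div, norm_pow, Complex.norm_natCast]
  have hsummable : Summable w := by
    refine Summable.of_norm ((summable_prod_of_nonneg fun _ => norm_nonneg _).2
      ⟨fun k => (hfiber' k).summable, ?_⟩)
    simp only [(hfiber' _).tsum_eq]
    refine ((Real.summable_pow_div_factorial (‖t * (x * y)‖ / (1 - ‖t * c‖))).mul_left
      (1 / (1 - ‖t * c‖))).congr fun k => ?_
    have : 1 - ‖t * c‖ ≠ 0 := (sub_pos.2 htc).ne'
    rw [div_pow, pow_succ]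
    field_simp
  have hD : 1 - t * c ≠ 0 := by
    intro h
    rw [← sub_eq_zero.1 h] at htc
    simp at htc
  have hexp := (NormedSpace.expSeries_div_hasSum_exp (𝔸 := ℂ)
    (t * (x * y) / (1 - t * c))).mul_left (1 / (1 - t * c))
  rw [← Complex.exp_eq_exp_ℂ] at hexp
  have hval : ∑' kn, w kn = Complex.exp (t * (x * y) / (1 - t * c)) / (1 - t * c) := by
    refine (hsummable.hasSum.prod_fiberwise hfiber).unique (hasSum_of_eq hexp (fun k => ?_) ?_)
    · rw [div_pow, pow_succ]
      field_simp
    · ring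
  have hanti := (Finset.HasAntidiagonal.sigmaAntidiagonalEquivProd.hasSum_iff.2
    (hval ▸ hsummable.hasSum)).sigma (fun m => hasSum_fintype _)
  refine hasSum_of_eq hanti (fun m => ?_) rfl
  rw [hermiteKernel_self_div_factorial, Finset.mul_sum, ← Finset.sum_coe_sort]
  refine Finset.sum_congr rfl fun kn _ => ?_
  obtain ⟨⟨k, n⟩, hkn⟩ := kn
  obtain rfl : k + n = m := by simpa using hkn
  simp only [Function.comp, Finset.HasAntidiagonal.sigmaAntidiagonalEquivProd, hw, Equiv.coe_fn_mk]
  rw [mul_pow t, mul_pow t, pow_add]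
  ring

theorem hasSum_hermiteKernel_superdiag {c t : ℂ} (x y : ℂ) (htc : ‖t * c‖ < 1) :
    HasSum (fun m => t ^ m * (hermiteKernel c x y m (m + 1) / (m ! : ℂ)))
      (y * (Complex.exp (t * (x * y) / (1 - t * c)) / (1 - t * c)) / (1 - t * c)) := by
  refine hasSum_of_geometric_recurrence htc ((hasSum_hermiteKernel_diag x y htc).mul_left y)
    (by simp [hermiteKernel_zero_left]) fun m => ?_
  have h1 : (m ! : ℂ) ≠ 0 := by exact_mod_cast m.factorial_ne_zero
  have h2 : (m + 1 : ℂ) ≠ 0 := by exact_mod_cast m.succ_ne_zero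
  rw [hermiteKernel_succ_right _ _ _ (m + 1) (m + 1), Nat.add_sub_cancel, Nat.factorial_succ]
  push_cast
  field_simp
  ring

theorem hasSum_hermiteKernel_subdiag {c t : ℂ} (x y : ℂ) (htc : ‖t * c‖ < 1) :
    HasSum (fun m => t ^ m * (hermiteKernel c x y (m + 1) m / (m ! : ℂ)))
      (x * (Complex.exp (t * (x * y) / (1 - t * c)) / (1 - t * c)) / (1 - t * c)) := by
  simpa only [hermiteKernel_swap c y x, mul_comm y x] using
    hasSum_hermiteKernel_superdiag y x htc

/-- By the left recurrence the left-hand side solves a geometric recurrence whose inhomogeneous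
term is a combination of the superdiagonal and diagonal series. -/
theorem hasSum_hermiteKernel_diag_succ {c t : ℂ} (x y : ℂ) (htc : ‖t * c‖ < 1) :
    HasSum (fun m => t ^ m * (hermiteKernel c x y (m + 1) (m + 1) / (m ! : ℂ)))
      ((x * (y * (Complex.exp (t * (x * y) / (1 - t * c)) / (1 - t * c)) / (1 - t * c)) +
        c * (Complex.exp (t * (x * y) / (1 - t * c)) / (1 - t * c))) / (1 - t * c)) := by
  refine hasSum_of_geometric_recurrence htc
    (((hasSum_hermiteKernel_superdiag x y htc).mul_left x).add
      ((hasSum_hermiteKernel_diag x y htc).mul_left c))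
    (by simp [hermiteKernel_succ_left, hermiteKernel_zero_left]) fun m => ?_
  have h1 : (m ! : ℂ) ≠ 0 := by exact_mod_cast m.factorial_ne_zero
  have h2 : (m + 1 : ℂ) ≠ 0 := by exact_mod_cast m.succ_ne_zero
  rw [hermiteKernel_succ_left _ _ _ (m + 1) (m + 2), Nat.factorial_succ,
    show m + 1 + 1 - 1 = m + 1 from rfl]
  push_cast
  field_simp
  ring

/-! ### Traces against the ladder operators of a lossy mode -/

theorem thermalLadder_apply_add (C : ℝ) (p q m : ℕ) :
    thermalLadder C p q (m + p) (m + q) =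
      ((C ^ m * Real.sqrt ((m + p).choose m * (m + q).choose m) : ℝ) : ℂ) := by
  rw [thermalLadder, tsum_eq_single m, Matrix.single_apply_same]
  intro k hk
  exact Matrix.single_apply_of_ne _ _ _ _ _ (by omega)

theorem thermalLadder_apply_eq_zero (C : ℝ) {p q i j : ℕ} (h : ∀ m, ¬(m + p = i ∧ m + q = j)) :
    thermalLadder C p q i j = 0 := by
  rw [thermalLadder]
  exact (tsum_congr fun m => Matrix.single_apply_of_ne _ _ _ _ _ (h m)).trans tsum_zero

theorem hasSum_thermalLadder_mul {C : ℝ} {p q : ℕ} {M : Matrix ℕ ℕ ℂ} {z : ℂ}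
    (h : HasSum (fun m => ((C ^ m * Real.sqrt ((m + p).choose m * (m + q).choose m) : ℝ) : ℂ) *
      M (m + q) (m + p)) z) :
    HasTraceMul (thermalLadder C p q) M z := by
  have hinj : Function.Injective fun m : ℕ => (m + p, m + q) := fun a b hab => by
    simpa using congrArg Prod.fst hab
  refine (hinj.hasSum_iff fun ij hij => ?_).1 (hasSum_of_eq h (fun m => ?_) rfl)
  · rw [thermalLadder_apply_eq_zero, zero_mul]
    rintro m ⟨h1, h2⟩
    exact hij ⟨m, Prod.ext h1 h2⟩
  · simp only [Function.comp, thermalLadder_apply_add]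

theorem hasSum_thermalLadder_diag {C : ℝ} {p : ℕ} {z : ℂ}
    (h : HasSum (fun m => ((C ^ m * (m + p).choose m : ℝ) : ℂ)) z) :
    HasOpTrace (thermalLadder C p p) z := by
  have hinj : Function.Injective fun m : ℕ => m + p := fun a b hab => by simpa using hab
  refine (hinj.hasSum_iff fun i hi => ?_).1 (hasSum_of_eq h (fun m => ?_) rfl)
  · refine thermalLadder_apply_eq_zero C ?_
    rintro m ⟨h1, -⟩
    exact hi ⟨m, h1⟩
  · simp only [Function.comp, thermalLadder_apply_add]
    rw [Real.sqrt_mul_self (by positivity)]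

theorem thermalLadder_diag_eq_zero (C : ℝ) {p q : ℕ} (hpq : p ≠ q) (i : ℕ) :
    thermalLadder C p q i i = 0 :=
  thermalLadder_apply_eq_zero C fun m => by omega

theorem hasSum_mul_prod {ι κ : Type*} {u : ι → ℂ} {w : κ → ℂ} {a b : ℂ}
    (hu : HasSum u a) (hw : HasSum w b) : HasSum (fun x : ι × κ => u x.1 * w x.2) (a * b) :=
  hu.mul hw (summable_mul_of_summable_norm hu.summable.norm hw.summable.norm)

theorem HasTraceMul.kronecker {ι κ : Type*} {S M : Matrix ι ι ℂ} {T N : Matrix κ κ ℂ} {a b : ℂ}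
    (hS : HasTraceMul S M a) (hT : HasTraceMul T N b) : HasTraceMul (S ⊗ₖ T) (M ⊗ₖ N) (a * b) := by
  have h := hasSum_mul_prod hS hT
  rw [← (Equiv.prodProdProdComm ι κ ι κ).hasSum_iff] at h
  refine hasSum_of_eq h (fun x => ?_) rfl
  simp only [Function.comp, Equiv.prodProdProdComm_apply, Matrix.kroneckerMap_apply]
  ring

theorem HasOpTrace.kronecker {ι κ : Type*} {S : Matrix ι ι ℂ} {T : Matrix κ κ ℂ} {a b : ℂ}
    (hS : HasOpTrace S a) (hT : HasOpTrace T b) : HasOpTrace (S ⊗ₖ T) (a * b) := by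
  have h := hasSum_mul_prod hS hT
  exact hasSum_of_eq h (fun _ => Matrix.kroneckerMap_apply _ _ _ _ _) rfl

theorem HasTraceMul.add {ι : Type*} {S T M : Matrix ι ι ℂ} {a b : ℂ}
    (hS : HasTraceMul S M a) (hT : HasTraceMul T M b) : HasTraceMul (S + T) M (a + b) :=
  hasSum_of_eq (HasSum.add hS hT) (fun _ => by rw [Matrix.add_apply, add_mul]) rfl

theorem HasTraceMul.smul {ι : Type*} {S M : Matrix ι ι ℂ} {a : ℂ} (z : ℂ)
    (hS : HasTraceMul S M a) : HasTraceMul (z • S) M (z * a) :=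
  hasSum_of_eq (HasSum.mul_left z hS)
    (fun _ => by rw [Matrix.smul_apply, smul_eq_mul, mul_assoc]) rfl

theorem HasOpTrace.add {ι : Type*} {S T : Matrix ι ι ℂ} {a b : ℂ}
    (hS : HasOpTrace S a) (hT : HasOpTrace T b) : HasOpTrace (S + T) (a + b) :=
  HasSum.add hS hT

theorem HasOpTrace.smul {ι : Type*} {S : Matrix ι ι ℂ} {a : ℂ} (z : ℂ)
    (hS : HasOpTrace S a) : HasOpTrace (z • S) (z * a) :=
  HasSum.mul_left z hS

/-- The Gaussian factor common to the traces of the operators `thermalLadder C p q` against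
`noClickPOVM η δ`. -/
def noClickGaussian (C η : ℝ) (δ : ℂ) : ℂ :=
  Complex.exp (-(η * (δ * conj δ))) *
    Complex.exp (C * (η * δ * (η * conj δ)) / (1 - C * (1 - η)))

section Traces

variable {C η : ℝ} (hC0 : 0 ≤ C) (hC1 : C < 1) (hη0 : 0 ≤ η) (hη1 : η ≤ 1) (δ : ℂ)
include hC0 hC1 hη0

theorem loss_mul_lt_one : C * (1 - η) < 1 :=
  (mul_le_of_le_one_right hC0 (sub_le_self 1 hη0)).trans_lt hC1

include hη1

theorem norm_loss_mul_lt_one : ‖(C : ℂ) * (1 - η)‖ < 1 := by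
  rw [show (C : ℂ) * (1 - η) = ((C * (1 - η) : ℝ) : ℂ) by push_cast; ring, Complex.norm_real,
    Real.norm_of_nonneg (mul_nonneg hC0 (sub_nonneg.2 hη1))]
  exact loss_mul_lt_one hC0 hC1 hη0

theorem hasTraceMul_thermalLadder_zero_zero :
    HasTraceMul (thermalLadder C 0 0) (noClickPOVM η δ)
      (noClickGaussian C η δ / (1 - C * (1 - η))) := by
  refine hasSum_thermalLadder_mul (hasSum_of_eq ((hasSum_hermiteKernel_diag (η * δ) (η * conj δ)
    (norm_loss_mul_lt_one hC0 hC1 hη0 hη1)).mul_left (Complex.exp (-(η * (δ * conj δ)))))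
    (fun m => ?_) ?_)
  · simp [noClickPOVM_apply, sqrtFactorial_mul_self]
    ring
  · rw [noClickGaussian]; ring

/-- The factor `√(m + 1)` of the ladder operator turns `√(m! (m + 1)!)` in the matrix element of
`noClickPOVM` into `m!`, which leaves the superdiagonal generating function. -/
theorem hasTraceMul_thermalLadder_one_zero :
    HasTraceMul (thermalLadder C 1 0) (noClickPOVM η δ)
      (η * conj δ * noClickGaussian C η δ / (1 - C * (1 - η)) ^ 2) := by
  refine hasSum_thermalLadder_mul (hasSum_of_eq ((hasSum_hermiteKernel_superdiag (η * δ)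
    (η * conj δ) (norm_loss_mul_lt_one hC0 hC1 hη0 hη1)).mul_left
      (Complex.exp (-(η * (δ * conj δ))))) (fun m => ?_) ?_)
  · have h := sqrtFactorial_ne_zero m
    have h' := sqrtFactorial_ne_zero (m + 1)
    rw [sqrtFactorial_succ] at h'
    rw [noClickPOVM_apply, add_zero, sqrtFactorial_succ, ← sqrtFactorial_mul_self m]
    simp only [Nat.choose_self, Nat.choose_succ_self_right, Nat.cast_one, mul_one,
      Complex.ofReal_mul, Complex.ofReal_pow]
    have h'' := left_ne_zero_of_mul h'
    field_simp
  · rw [noClickGaussian]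
    generalize 1 - (C : ℂ) * (1 - η) = D
    ring

theorem hasTraceMul_thermalLadder_zero_one :
    HasTraceMul (thermalLadder C 0 1) (noClickPOVM η δ)
      (η * δ * noClickGaussian C η δ / (1 - C * (1 - η)) ^ 2) := by
  refine hasSum_thermalLadder_mul (hasSum_of_eq ((hasSum_hermiteKernel_subdiag (η * δ)
    (η * conj δ) (norm_loss_mul_lt_one hC0 hC1 hη0 hη1)).mul_left
      (Complex.exp (-(η * (δ * conj δ))))) (fun m => ?_) ?_)
  · have h := sqrtFactorial_ne_zero m
    have h' := sqrtFactorial_ne_zero (m + 1)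
    rw [sqrtFactorial_succ] at h'
    rw [noClickPOVM_apply, add_zero, sqrtFactorial_succ, ← sqrtFactorial_mul_self m]
    simp only [Nat.choose_self, Nat.choose_succ_self_right, Nat.cast_one, one_mul,
      Complex.ofReal_mul, Complex.ofReal_pow]
    have h'' := left_ne_zero_of_mul h'
    field_simp
  · rw [noClickGaussian]
    generalize 1 - (C : ℂ) * (1 - η) = D
    ring

theorem hasTraceMul_thermalLadder_one_one :
    HasTraceMul (thermalLadder C 1 1) (noClickPOVM η δ)
      ((η ^ 2 * (δ * conj δ) / (1 - C * (1 - η)) + (1 - η)) * noClickGaussian C η δ /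
        (1 - C * (1 - η)) ^ 2) := by
  refine hasSum_thermalLadder_mul (hasSum_of_eq ((hasSum_hermiteKernel_diag_succ (η * δ)
    (η * conj δ) (norm_loss_mul_lt_one hC0 hC1 hη0 hη1)).mul_left
      (Complex.exp (-(η * (δ * conj δ))))) (fun m => ?_) ?_)
  · have h1 : (m ! : ℂ) ≠ 0 := by exact_mod_cast m.factorial_ne_zero
    have h2 : (m + 1 : ℂ) ≠ 0 := by exact_mod_cast m.succ_ne_zero
    rw [noClickPOVM_apply, sqrtFactorial_mul_self, Real.sqrt_mul_self (by positivity),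
      Nat.choose_succ_self_right, Nat.factorial_succ]
    push_cast
    field_simp
  · rw [noClickGaussian]
    generalize 1 - (C : ℂ) * (1 - η) = D
    ring

end Traces

/-! ### The lossy heralded state with partial coherence -/

/-- The unnormalized lossy heralded state with visibility amplitude `v`: the coherences between
the terms with the photon in the first and in the second mode are multiplied by `v` or `v*`. -/
def mixedHeralded (C : ℝ) (v : ℂ) : Matrix (ℕ × ℕ) (ℕ × ℕ) ℂ :=
  (1 / 2 : ℂ) • (thermalLadder C 0 0 ⊗ₖ thermalLadder C 1 1 +
    thermalLadder C 1 1 ⊗ₖ thermalLadder C 0 0 +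
    (Complex.I * conj v) • (thermalLadder C 1 0 ⊗ₖ thermalLadder C 0 1) +
    -(Complex.I * v) • (thermalLadder C 0 1 ⊗ₖ thermalLadder C 1 0))

theorem noClickGaussian_mul {C η : ℝ} (hD : 1 - C * (1 - η) ≠ 0) (α β : ℂ) :
    noClickGaussian C η α * noClickGaussian C η β =
      (Real.exp (-(η * (1 - C) * (‖α‖ ^ 2 + ‖β‖ ^ 2)) / (1 - C * (1 - η))) : ℂ) := by
  have hD' : (1 - C * (1 - η) : ℂ) ≠ 0 := by exact_mod_cast hD
  rw [noClickGaussian, noClickGaussian, Complex.ofReal_exp]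
  simp only [← Complex.exp_add]
  congr 1
  push_cast
  rw [← Complex.mul_conj' α, ← Complex.mul_conj' β]
  field_simp
  ring

/-- The two coherences contribute complex conjugate terms, whose sum is the imaginary part in the
formula. -/
theorem hasTraceMul_mixedHeralded {C η : ℝ} (hC0 : 0 ≤ C) (hC1 : C < 1) (hη0 : 0 ≤ η)
    (hη1 : η ≤ 1) (v α β : ℂ) :
    HasTraceMul ((((1 - C) ^ 3 : ℝ) : ℂ) • mixedHeralded C v)
      (noClickPOVM η α ⊗ₖ noClickPOVM η β)
      (((1 - C) ^ 3 / 2 *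
        ((2 * (1 - η) * (1 - C * (1 - η)) +
            η ^ 2 * (‖α‖ ^ 2 + ‖β‖ ^ 2 + 2 * (v * α * conj β).im)) /
          (1 - C * (1 - η)) ^ 4) *
        Real.exp (-(η * (1 - C) * (‖α‖ ^ 2 + ‖β‖ ^ 2)) / (1 - C * (1 - η))) : ℝ) : ℂ) := by
  have hD : 1 - C * (1 - η) ≠ 0 := (sub_pos.2 (loss_mul_lt_one hC0 hC1 hη0)).ne'
  have hD' : (1 - C * (1 - η) : ℂ) ≠ 0 := by exact_mod_cast hD
  have h00 := fun δ => hasTraceMul_thermalLadder_zero_zero hC0 hC1 hη0 hη1 δ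
  have h01 := fun δ => hasTraceMul_thermalLadder_zero_one hC0 hC1 hη0 hη1 δ
  have h10 := fun δ => hasTraceMul_thermalLadder_one_zero hC0 hC1 hη0 hη1 δ
  have h11 := fun δ => hasTraceMul_thermalLadder_one_one hC0 hC1 hη0 hη1 δ
  refine hasSum_of_eq (((((h00 α).kronecker (h11 β)).add ((h11 α).kronecker (h00 β))).add
    (((h10 α).kronecker (h01 β)).smul (Complex.I * conj v)) |>.add
    (((h01 α).kronecker (h10 β)).smul (-(Complex.I * v)))).smul (1 / 2) |>.smul
      (((1 - C) ^ 3 : ℝ) : ℂ)) (fun _ => rfl) ?_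
  have him : (2 * (v * α * conj β).im : ℂ) =
      Complex.I * (conj v * conj α * β) - Complex.I * (v * α * conj β) := by
    have h := Complex.sub_conj (v * α * conj β)
    simp only [map_mul, Complex.conj_conj, Complex.ofReal_mul, Complex.ofReal_ofNat] at h
    linear_combination Complex.I * h + (2 * (v * α * conj β).im : ℂ) * Complex.I_mul_I
  have hE := noClickGaussian_mul hD α β
  push_cast at hE ⊢
  rw [him, ← hE, ← Complex.mul_conj' α, ← Complex.mul_conj' β]
  field_simp
  ring

theorem hasOpTrace_mixedHeralded {C : ℝ} (hC0 : 0 ≤ C) (hC1 : C < 1) (v : ℂ) :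
    HasOpTrace (mixedHeralded C v) (1 / (1 - C) ^ 3 : ℂ) := by
  have hC : ‖(C : ℂ)‖ < 1 := by rwa [Complex.norm_real, Real.norm_of_nonneg hC0]
  have hD : (1 - C : ℂ) ≠ 0 := by exact_mod_cast (sub_pos.2 hC1).ne'
  have h0 : HasOpTrace (thermalLadder C 0 0) (1 / (1 - C) ^ (0 + 1) : ℂ) :=
    hasSum_thermalLadder_diag (hasSum_of_eq (hasSum_choose_mul_geometric_of_norm_lt_one 0 hC)
      (fun m => by simp) rfl)
  have h1 : HasOpTrace (thermalLadder C 1 1) (1 / (1 - C) ^ (1 + 1) : ℂ) :=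
    hasSum_thermalLadder_diag (hasSum_of_eq (hasSum_choose_mul_geometric_of_norm_lt_one 1 hC)
      (fun m => by simp [mul_comm]) rfl)
  have hz : ∀ p q r s : ℕ, p ≠ q →
      HasOpTrace (thermalLadder C p q ⊗ₖ thermalLadder C r s) 0 := fun p q r s hpq =>
    hasSum_of_eq hasSum_zero
      (fun x => by rw [Matrix.kronecker_apply, thermalLadder_diag_eq_zero C hpq, zero_mul]) rfl
  refine hasSum_of_eq (((((h0.kronecker h1).add (h1.kronecker h0)).add
    ((hz 1 0 0 1 one_ne_zero).smul (Complex.I * conj v))).add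
    ((hz 0 1 1 0 zero_ne_one).smul (-(Complex.I * v)))).smul (1 / 2)) (fun _ => rfl) ?_
  field_simp
  ring

/-- Perfect mode overlap is the case `v = 1`. -/
theorem onePhotonState_eq (C : ℝ) :
    onePhotonState C = (((1 - C) ^ 3 : ℝ) : ℂ) • mixedHeralded C 1 := by
  have h2 : (1 / (Real.sqrt 2 : ℂ)) * (1 / (Real.sqrt 2 : ℂ)) = 1 / 2 := by
    have : (Real.sqrt 2 : ℂ) * (Real.sqrt 2 : ℂ) = 2 := by
      rw [← Complex.ofReal_mul, Real.mul_self_sqrt (by norm_num)]; simp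
    rw [div_mul_div_comm, this, one_mul]
  have e00 : onePhotonAmp 0 * conj (onePhotonAmp 0) = 1 / 2 := by
    simpa [onePhotonAmp] using h2
  have e11 : onePhotonAmp 1 * conj (onePhotonAmp 1) = 1 / 2 := by
    simp only [onePhotonAmp, one_ne_zero, if_false, if_true, map_div₀, Complex.conj_I,
      Complex.conj_ofReal]
    linear_combination h2 - (1 / (Real.sqrt 2 : ℂ)) * (1 / (Real.sqrt 2 : ℂ)) * Complex.I_mul_I
  have e01 : onePhotonAmp 0 * conj (onePhotonAmp 1) = -(Complex.I) / 2 := by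
    simp only [onePhotonAmp, one_ne_zero, if_false, if_true, map_div₀, Complex.conj_I,
      Complex.conj_ofReal]
    linear_combination -Complex.I * h2
  have e10 : onePhotonAmp 1 * conj (onePhotonAmp 0) = Complex.I / 2 := by
    simp only [onePhotonAmp, one_ne_zero, if_false, if_true, map_div₀, map_one,
      Complex.conj_ofReal]
    linear_combination Complex.I * h2
  rw [onePhotonState, lossyHeraldedState, mixedHeralded]
  simp only [Finset.sum_range_succ, Finset.sum_range_zero, zero_add, e00, e01, e10, e11,
    Nat.sub_zero, Nat.sub_self, map_one]
  module

/-! ### Heralding with imperfect spectral overlap -/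

/-- The Kronecker symbol, with complex values. -/
def kroneckerDelta (k P : ℕ) : ℂ := if k = P then 1 else 0

theorem heraldAmp_wavePackets (f h : ℝ → ℂ) (k l : ℕ) (ω : ℝ) :
    heraldAmp ω (wavePackets f h k l) =
      (kroneckerDelta k 1 * kroneckerDelta l 0 * f ω -
        Complex.I * (kroneckerDelta k 0 * kroneckerDelta l 1 * h ω)) / (Real.sqrt 2 : ℂ) := by
  have h1 : vacuumAmp (annihilateFst ω (wavePackets f h k l)) =
      kroneckerDelta k 1 * kroneckerDelta l 0 * f ω := by
    rw [kroneckerDelta, kroneckerDelta, ite_zero_mul_ite_zero, vacuumAmp, annihilateFst,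
      wavePackets]
    simp [eq_comm]
  have h2 : vacuumAmp (annihilateSnd ω (wavePackets f h k l)) =
      kroneckerDelta k 0 * kroneckerDelta l 1 * h ω := by
    rw [kroneckerDelta, kroneckerDelta, ite_zero_mul_ite_zero, vacuumAmp, annihilateSnd,
      wavePackets]
    simp [eq_comm]
  rw [heraldAmp, h1, h2]

theorem conj_kroneckerDelta (k P : ℕ) : conj (kroneckerDelta k P) = kroneckerDelta k P := by
  rw [kroneckerDelta]; split_ifs <;> simp

theorem integrable_mul_conj_of_memLp {u w : ℝ → ℂ} (hu : MemLp u 2 volume) (hw : MemLp w 2 volume) :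
    Integrable (fun ω => u ω * conj (w ω)) volume :=
  hu.integrable_mul hw.star

theorem IsSpectralAmplitude.integral_mul_conj {f : ℝ → ℂ} (hf : IsSpectralAmplitude f) :
    ∫ ω, f ω * conj (f ω) = 1 := by
  have h := integral_ofReal (𝕜 := ℂ) (μ := volume) (f := fun ω => ‖f ω‖ ^ 2)
  rw [hf.2] at h
  simpa [Complex.mul_conj'] using h

theorem integral_linear_combination_four {u₁ u₂ u₃ u₄ : ℝ → ℂ} (h₁ : Integrable u₁)
    (h₂ : Integrable u₂) (h₃ : Integrable u₃) (h₄ : Integrable u₄) (a b c d : ℂ) :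
    ∫ ω, (a * u₁ ω + b * u₂ ω + c * u₃ ω + d * u₄ ω) =
      a * (∫ ω, u₁ ω) + b * (∫ ω, u₂ ω) + c * (∫ ω, u₃ ω) + d * ∫ ω, u₄ ω := by
  have h₁₂ : Integrable fun ω => a * u₁ ω + b * u₂ ω := (h₁.const_mul a).add (h₂.const_mul b)
  have h₁₂₃ : Integrable fun ω => a * u₁ ω + b * u₂ ω + c * u₃ ω := h₁₂.add (h₃.const_mul c)
  rw [integral_add h₁₂₃ (h₄.const_mul d), integral_add h₁₂ (h₃.const_mul c),
    integral_add (h₁.const_mul a) (h₂.const_mul b)]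
  simp only [integral_const_mul]

/-- Exactly one idler photon is found, in the first or in the second beam; the cross terms carry
the overlap of the two spectral amplitudes. -/
theorem heraldOverlap_eq {f h : ℝ → ℂ} (hf : IsSpectralAmplitude f) (hh : IsSpectralAmplitude h)
    (k l k' l' : ℕ) :
    heraldOverlap f h k l k' l' = 1 / 2 *
      (kroneckerDelta k 0 * kroneckerDelta k' 0 * (kroneckerDelta l 1 * kroneckerDelta l' 1) +
        kroneckerDelta k 1 * kroneckerDelta k' 1 * (kroneckerDelta l 0 * kroneckerDelta l' 0) +
        Complex.I * conj (visibilityAmp f h) *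
          (kroneckerDelta k 1 * kroneckerDelta k' 0 * (kroneckerDelta l 0 * kroneckerDelta l' 1)) +
        -(Complex.I * visibilityAmp f h) *
          (kroneckerDelta k 0 * kroneckerDelta k' 1 *
            (kroneckerDelta l 1 * kroneckerDelta l' 0))) := by
  have h2 : (Real.sqrt 2 : ℂ) * (Real.sqrt 2 : ℂ) = 2 := by
    rw [← Complex.ofReal_mul, Real.mul_self_sqrt (by norm_num)]; simp
  have hff := integrable_mul_conj_of_memLp hf.1 hf.1
  have hfh := integrable_mul_conj_of_memLp hf.1 hh.1
  have hhf := integrable_mul_conj_of_memLp hh.1 hf.1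
  have hhh := integrable_mul_conj_of_memLp hh.1 hh.1
  have hv : ∫ ω, h ω * conj (f ω) = visibilityAmp f h := by
    simp only [visibilityAmp, mul_comm]
  have hv' : ∫ ω, f ω * conj (h ω) = conj (visibilityAmp f h) := by
    rw [visibilityAmp, ← integral_conj]
    simp only [map_mul, Complex.conj_conj]
  have key : ∀ ω, heraldAmp ω (wavePackets f h k l) * conj (heraldAmp ω (wavePackets f h k' l')) =
      1 / 2 * (kroneckerDelta k 0 * kroneckerDelta k' 0 *
          (kroneckerDelta l 1 * kroneckerDelta l' 1)) * (h ω * conj (h ω)) +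
      1 / 2 * (kroneckerDelta k 1 * kroneckerDelta k' 1 *
          (kroneckerDelta l 0 * kroneckerDelta l' 0)) * (f ω * conj (f ω)) +
      1 / 2 * Complex.I * (kroneckerDelta k 1 * kroneckerDelta k' 0 *
          (kroneckerDelta l 0 * kroneckerDelta l' 1)) * (f ω * conj (h ω)) +
      -(1 / 2 * Complex.I) * (kroneckerDelta k 0 * kroneckerDelta k' 1 *
          (kroneckerDelta l 1 * kroneckerDelta l' 0)) * (h ω * conj (f ω)) := by
    intro ω
    simp only [heraldAmp_wavePackets, map_div₀, map_sub, map_mul, conj_kroneckerDelta,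
      Complex.conj_I, Complex.conj_ofReal]
    rw [div_mul_div_comm, h2]
    linear_combination (-1 / 2 * (kroneckerDelta k 0 * kroneckerDelta k' 0 *
          (kroneckerDelta l 1 * kroneckerDelta l' 1)) * (h ω * conj (h ω))) * Complex.I_mul_I
  rw [heraldOverlap, integral_congr_ae (Filter.Eventually.of_forall key),
    integral_linear_combination_four hhh hff hfh hhf, hv, hv', hf.integral_mul_conj,
    hh.integral_mul_conj]
  ring

/-- One squeezed vacuum whose idler has passed the lossy channel: if `P` and `Q` idler photons
survive in the row and in the column, tracing out the lost photons leaves the operator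
`thermalLadder` of parameter `r tanh² g` on the signal mode. -/
theorem squeezed_sum_lossAmp_eq {g r C : ℝ} (hr0 : 0 ≤ r) (hr1 : r ≤ 1)
    (hC : C = r * Real.tanh g ^ 2) (P Q n n' : ℕ) :
    ((squeezedAmp g n * squeezedAmp g n' : ℝ) : ℂ) *
      ∑ p ∈ Finset.range (min n n' + 1), ((lossAmp r n p * lossAmp r n' p : ℝ) : ℂ) *
        (kroneckerDelta (n - p) P * kroneckerDelta (n' - p) Q) =
      ((Real.tanh g ^ (P + Q) * Real.sqrt (1 - r) ^ (P + Q) / Real.cosh g ^ 2 : ℝ) : ℂ) *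
        thermalLadder C P Q n n' := by
  by_cases h : ∃ m, m + P = n ∧ m + Q = n'
  · obtain ⟨m, rfl, rfl⟩ := h
    -- Only the term in which exactly `m` photons are lost survives.
    rw [thermalLadder_apply_add, Finset.sum_eq_single_of_mem m (by simp)]
    · have hl : ∀ R, lossAmp r (m + R) m =
          Real.sqrt ((m + R).choose m) * Real.sqrt (1 - r) ^ R * Real.sqrt (r ^ m) := fun R => by
        have h1r : 0 ≤ 1 - r := sub_nonneg.2 hr1
        have hpow : Real.sqrt ((1 - r) ^ R) = Real.sqrt (1 - r) ^ R := by
          rw [← Real.sqrt_sq (pow_nonneg (Real.sqrt_nonneg (1 - r)) R), ← pow_mul, mul_comm R,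
            pow_mul, Real.sq_sqrt h1r]
        rw [lossAmp, Nat.add_sub_cancel_left, Real.sqrt_mul (by positivity),
          Real.sqrt_mul (by positivity), hpow]
      have hs : Real.sqrt (r ^ m) * Real.sqrt (r ^ m) = r ^ m :=
        Real.mul_self_sqrt (pow_nonneg hr0 m)
      have hk : ∀ R, kroneckerDelta (m + R - m) R = 1 := fun R => by simp [kroneckerDelta]
      rw [hk, hk, mul_one, mul_one, ← Complex.ofReal_mul, ← Complex.ofReal_mul, hl, hl, hC, mul_pow,
        Real.sqrt_mul (Nat.cast_nonneg _), squeezedAmp, squeezedAmp]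
      congr 1
      linear_combination (Real.tanh g ^ (m + P) * Real.tanh g ^ (m + Q) / Real.cosh g ^ 2 *
        Real.sqrt ((m + P).choose m) * Real.sqrt ((m + Q).choose m) *
          Real.sqrt (1 - r) ^ (P + Q)) * hs
    · intro p hp hpm
      have : p ≤ m + P := by simp at hp; omega
      rw [kroneckerDelta, if_neg (by omega)]
      simp
  · rw [thermalLadder_apply_eq_zero C (fun m hm => h ⟨m, hm⟩), mul_zero, Finset.sum_eq_zero,
      mul_zero]
    intro p hp
    simp only [Finset.mem_range, Nat.lt_succ_iff, le_min_iff] at hp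
    rw [kroneckerDelta, kroneckerDelta, ite_zero_mul_ite_zero, if_neg, mul_zero]
    rintro ⟨h1, h2⟩
    exact h ⟨p, by omega, by omega⟩

theorem unnormalizedHeralded_eq {g r C : ℝ} (hr0 : 0 ≤ r) (hr1 : r ≤ 1)
    (hC : C = r * Real.tanh g ^ 2) {f h : ℝ → ℂ} (hf : IsSpectralAmplitude f)
    (hh : IsSpectralAmplitude h) :
    unnormalizedHeralded g r f h =
      ((Real.tanh g ^ 2 * (1 - r) / Real.cosh g ^ 4 : ℝ) : ℂ) •
        mixedHeralded C (visibilityAmp f h) := by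
  have hsum : ∀ (x y : ℕ × ℕ) (P Q R S : ℕ), P + Q + (R + S) = 2 →
      ((squeezedAmp g x.1 * squeezedAmp g x.2 * squeezedAmp g y.1 * squeezedAmp g y.2 : ℝ) : ℂ) *
        ∑ p ∈ Finset.range (min x.1 y.1 + 1), ∑ q ∈ Finset.range (min x.2 y.2 + 1),
          ((lossAmp r x.1 p * lossAmp r y.1 p * lossAmp r x.2 q * lossAmp r y.2 q : ℝ) : ℂ) *
            (kroneckerDelta (x.1 - p) P * kroneckerDelta (y.1 - p) Q *
              (kroneckerDelta (x.2 - q) R * kroneckerDelta (y.2 - q) S)) =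
      ((Real.tanh g ^ 2 * (1 - r) / Real.cosh g ^ 4 : ℝ) : ℂ) *
        (thermalLadder C P Q ⊗ₖ thermalLadder C R S) x y := by
    intro x y P Q R S hPQ
    -- The exponents add up to `2`: one idler photon is detected in the row, one in the column.
    have hκ : Real.tanh g ^ 2 * (1 - r) / Real.cosh g ^ 4 =
        (Real.tanh g ^ (P + Q) * Real.sqrt (1 - r) ^ (P + Q) / Real.cosh g ^ 2) *
          (Real.tanh g ^ (R + S) * Real.sqrt (1 - r) ^ (R + S) / Real.cosh g ^ 2) := by
      rw [div_mul_div_comm, mul_mul_mul_comm, ← pow_add, ← pow_add, hPQ,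
        Real.sq_sqrt (sub_nonneg.2 hr1), ← pow_add]
    have hT : ∀ a b : ℂ, ((Real.tanh g ^ 2 * (1 - r) / Real.cosh g ^ 4 : ℝ) : ℂ) * (a * b) =
        ((Real.tanh g ^ (P + Q) * Real.sqrt (1 - r) ^ (P + Q) / Real.cosh g ^ 2 : ℝ) : ℂ) * a *
          (((Real.tanh g ^ (R + S) * Real.sqrt (1 - r) ^ (R + S) / Real.cosh g ^ 2 : ℝ) : ℂ) *
            b) := fun a b => by
      rw [hκ, Complex.ofReal_mul, mul_mul_mul_comm]
    rw [Matrix.kroneckerMap_apply, hT, ← squeezed_sum_lossAmp_eq hr0 hr1 hC,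
      ← squeezed_sum_lossAmp_eq hr0 hr1 hC, mul_mul_mul_comm, Finset.sum_mul_sum]
    refine congrArg₂ (· * ·) ?_ ?_
    · push_cast
      ring
    · refine Finset.sum_congr rfl fun p _ => Finset.sum_congr rfl fun q _ => ?_
      push_cast
      ring
  ext x y
  have expand : ∀ κ a b c d e e' : ℂ, κ * (1 / 2 * (a + b + e * c + e' * d)) =
      1 / 2 * (κ * a + κ * b + e * (κ * c) + e' * (κ * d)) := by intros; ring
  rw [unnormalizedHeralded]
  simp only [heraldOverlap_eq hf hh]
  rw [Matrix.smul_apply, mixedHeralded]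
  simp only [Matrix.smul_apply, Matrix.add_apply, smul_eq_mul]
  have h1 := hsum x y 0 0 1 1 rfl
  have h2 := hsum x y 1 1 0 0 rfl
  have h3 := hsum x y 1 0 0 1 rfl
  have h4 := hsum x y 0 1 1 0 rfl
  rw [expand, ← h1, ← h2, ← h3, ← h4]
  simp only [Finset.mul_sum, ← Finset.sum_add_distrib]
  refine Finset.sum_congr rfl fun p _ => Finset.sum_congr rfl fun q _ => ?_
  ring

/-- The conditions `g ≠ 0` and `r < 1` make the heralding probability nonzero, so that normalizing
by it is not a division by zero. -/
theorem heraldedState_eq {g r C : ℝ} (hr0 : 0 ≤ r) (hr1 : r < 1) (hg : g ≠ 0)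
    (hC : C = r * Real.tanh g ^ 2) (hC0 : 0 ≤ C) (hC1 : C < 1) {f h : ℝ → ℂ}
    (hf : IsSpectralAmplitude f) (hh : IsSpectralAmplitude h) :
    heraldedState g r f h =
      (((1 - C) ^ 3 : ℝ) : ℂ) • mixedHeralded C (visibilityAmp f h) := by
  have hκ : ((Real.tanh g ^ 2 * (1 - r) / Real.cosh g ^ 4 : ℝ) : ℂ) ≠ 0 := by
    have h1 : Real.tanh g ≠ 0 := by
      rw [Real.tanh_eq_sinh_div_cosh]
      exact div_ne_zero (Real.sinh_ne_zero.2 hg) (Real.cosh_pos g).ne'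
    exact_mod_cast div_ne_zero (mul_ne_zero (pow_ne_zero 2 h1) (sub_pos.2 hr1).ne')
      (pow_ne_zero 4 (Real.cosh_pos g).ne')
  have hD : (1 - C : ℂ) ≠ 0 := by exact_mod_cast (sub_pos.2 hC1).ne'
  have ht := (hasOpTrace_mixedHeralded hC0 hC1 (visibilityAmp f h)).smul
    ((Real.tanh g ^ 2 * (1 - r) / Real.cosh g ^ 4 : ℝ) : ℂ)
  rw [heraldedState, heraldingProb, unnormalizedHeralded_eq hr0 hr1.le hC hf hh, ht.tsum_eq,
    smul_smul]
  congr 1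
  rw [Complex.ofReal_pow, Complex.ofReal_sub, Complex.ofReal_one]
  field_simp

theorem hasOpTrace_normalized_mixedHeralded {C : ℝ} (hC0 : 0 ≤ C) (hC1 : C < 1) (v : ℂ) :
    HasOpTrace ((((1 - C) ^ 3 : ℝ) : ℂ) • mixedHeralded C v) 1 := by
  have hD : (1 - C : ℂ) ≠ 0 := by exact_mod_cast (sub_pos.2 hC1).ne'
  refine hasSum_of_eq ((hasOpTrace_mixedHeralded hC0 hC1 v).smul (((1 - C) ^ 3 : ℝ) : ℂ))
    (fun _ => rfl) ?_
  rw [Complex.ofReal_pow, Complex.ofReal_sub, Complex.ofReal_one]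
  field_simp

end TwinField

end

theorem mainTheorem3 (g r η C : ℝ) (hr0 : 0 ≤ r) (hr1 : r ≤ 1) (hη0 : 0 ≤ η) (hη1 : η ≤ 1)
    (hC : C = r * Real.tanh g ^ 2) (α β : ℂ) :
    -- the series that define the displaced no-click measurements converge
    (∀ δ : ℂ,
      (∀ i j, Summable (TwinField.opExpTerm (TwinField.displacementGenerator δ) i j)) ∧
      TwinField.OpMulSummable
        (TwinField.opMul (TwinField.displacement δ) (TwinField.noClick η))
        (TwinField.displacement δ)ᴴ) ∧
    -- perfect mode overlap
    (TwinField.HasOpTrace (TwinField.onePhotonState C) 1 ∧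
      TwinField.HasTraceMul (TwinField.onePhotonState C)
        (TwinField.noClickPOVM η α ⊗ₖ TwinField.noClickPOVM η β)
        (((1 - C) ^ 3 / 2 *
          ((2 * (1 - η) * (1 - C * (1 - η)) +
              η ^ 2 * (‖α‖ ^ 2 + ‖β‖ ^ 2 + 2 * (α * conj β).im)) /
            (1 - C * (1 - η)) ^ 4) *
          Real.exp (-(η * (1 - C) * (‖α‖ ^ 2 + ‖β‖ ^ 2)) / (1 - C * (1 - η))) : ℝ) : ℂ)) ∧
    -- imperfect mode overlap
    (g ≠ 0 → r < 1 → ∀ f h : ℝ → ℂ,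
      TwinField.IsSpectralAmplitude f → TwinField.IsSpectralAmplitude h →
      TwinField.HasOpTrace (TwinField.heraldedState g r f h) 1 ∧
      TwinField.HasTraceMul (TwinField.heraldedState g r f h)
        (TwinField.noClickPOVM η α ⊗ₖ TwinField.noClickPOVM η β)
        (((1 - C) ^ 3 / 2 *
          ((2 * (1 - η) * (1 - C * (1 - η)) +
              η ^ 2 * (‖α‖ ^ 2 + ‖β‖ ^ 2 +
                2 * (TwinField.visibilityAmp f h * α * conj β).im)) /
            (1 - C * (1 - η)) ^ 4) *
          Real.exp (-(η * (1 - C) * (‖α‖ ^ 2 + ‖β‖ ^ 2)) / (1 - C * (1 - η))) : ℝ) : ℂ)) := by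
  have hC0 : 0 ≤ C := hC ▸ mul_nonneg hr0 (sq_nonneg _)
  have hC1 : C < 1 := by
    have : Real.tanh g ^ 2 < 1 := (sq_lt_one_iff_abs_lt_one _).2 (Real.abs_tanh_lt_one g)
    rw [hC]
    exact (mul_le_of_le_one_left (sq_nonneg _) hr1).trans_lt this
  refine ⟨fun δ => ⟨fun i j => (TwinField.hasSum_opExpTerm_displacementGenerator δ i j).summable,
    fun i j => (TwinField.hasSum_noClickPOVM η δ i j).summable⟩, ?_, ?_⟩
  · rw [TwinField.onePhotonState_eq]
    refine ⟨TwinField.hasOpTrace_normalized_mixedHeralded hC0 hC1 1, ?_⟩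
    simpa only [one_mul] using TwinField.hasTraceMul_mixedHeralded hC0 hC1 hη0 hη1 1 α β
  · intro hg hr f h hf hh
    rw [TwinField.heraldedState_eq hr0 hr hg hC hC0 hC1 hf hh]
    exact ⟨TwinField.hasOpTrace_normalized_mixedHeralded hC0 hC1 _,
      TwinField.hasTraceMul_mixedHeralded hC0 hC1 hη0 hη1 _ α β⟩
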